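/- Let $|\pm\rangle=(|0\rangle\pm|1\rangle)/\sqrt2$, $|i_\pm\rangle=(|0\rangle\pm i|1\rangle)/\sqrt2$, and let $$|D_1\rangle=|0\rangle_A|0\rangle_B,\quad |D_2\rangle=|1\rangle_A|1\rangle_B,\quad |D_3\rangle=|+\rangle_A|+\rangle_B,\quad |D_4\rangle=|i_+\rangle_A|i_-\rangle_B$$ be the Duan states in $\mathbb C^2\otimes\mathbb C^2$; write $|D_j\rangle=|a_j\rangle_A|b_j\rangle_B$. A finite family of states $(\rho_j)$ is called antidistinguishable if there is a POVM $(\Pi_j)$ with the same index set such that $\operatorname{Tr}(\rho_j\Pi_j)=0$ and $\sum_i\operatorname{Tr}(\rho_i\Pi_j)>0$ for every $j$. Suppose that $|D_i\rangle\otimes|D_j\rangle$, for an unknown one of the twelve ordered pairs $(i,j)$ with $i\ne j$, is shared by Alice (who holds $A_1A_2$) and Bob (who holds $B_1B_2$). Then: 1. The Duan states admit $(2,1)$-local state antimarking (LSAM): there is a (finite-round) LOCC protocol that in every run outputs an ordered pair $(x,y)$, $x\neq y$, which is certainly different from $(i,j)$. The protocol can moreover be chosen so that each of the twelve pairs is output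 with positive probability on some input, i.e. the twelve two-copy states are antidistinguishable (in the above sense) by LOCC. 2. For each party, the set of the twelve local two-copy states ($|a_i\rangle|a_j\rangle$ for Alice, $|b_i\rangle|b_j\rangle$ for Bob, $i\neq j$) is covered by four antidistinguishable triples, namely those with index pairs $\{12,21,34\}$, $\{13,23,42\}$, $\{14,24,43\}$ and $\{41,31,32\}$; and the whole set of twelve local states is antidistinguishable. In contrast, neither party's set of single-copy local states ($\{|a_j\rangle\}_{j=1}^4$, $\{|b_j\rangle\}_{j=1}^4$) is antidistinguishable. 3. The Duan states are nonlocal for $2$-conclusive local state marking ($2$-CLSM): there is a global measurement, but no (finite-round) LOCC protocol, that outputs either an ordered pair of distinct indices or "inconclusive", never outputs a wrong pair, and identifies each of the twelve pairs $(i,j)$ with positive probability when it is the input. -/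

import Mathlib

open scoped Matrix Kronecker ComplexOrder

noncomputable section

namespace Antimarking

/-- The density matrix `|ψ⟩⟨ψ|` of a vector `ψ`. -/
def pureState {H : Type} (ψ : H → ℂ) : Matrix H H ℂ :=
  Matrix.vecMulVec ψ (star ψ)

/-- Born rule: the probability `Tr(ρ E)` of the effect `E` on the state `ρ`. -/
def prob {H : Type} [Fintype H] (ρ E : Matrix H H ℂ) : ℝ :=
  (ρ * E).trace.re

/-- A positive operator-valued measure with finitely many outcomes. -/
def IsPOVM {H Ω : Type} [Fintype H] [DecidableEq H] [Fintype Ω]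
    (E : Ω → Matrix H H ℂ) : Prop :=
  (∀ ω, (E ω).PosSemidef) ∧ ∑ ω, E ω = 1

/-- (Strong) antidistinguishability: some POVM, indexed by the states, has outcome `j` never
occurring on the state `j`, while every outcome occurs with positive probability on some state. -/
def Antidistinguishable {H σ : Type} [Fintype H] [DecidableEq H] [Fintype σ]
    (ρ : σ → Matrix H H ℂ) : Prop :=
  ∃ E : σ → Matrix H H ℂ, IsPOVM E ∧
    (∀ j, prob (ρ j) (E j) = 0) ∧ (∀ j, 0 < ∑ i, prob (ρ i) (E j))

/-- A finite-round LOCC measurement protocol with classical output in `Ω`, for two parties holding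
systems with basis sets `α` and `β`. In each round one of the parties performs a measurement,
given by Kraus operators `K i` (with output spaces of any finite dimension) satisfying
`∑ i, (K i)ᴴ * K i = 1`, and announces the outcome `i`; the rest of the protocol may depend on all
outcomes so far. -/
inductive LOCC (Ω : Type) : (α β : Type) → [Fintype α] → [DecidableEq α] →
    [Fintype β] → [DecidableEq β] → Type 1
  | output {α β : Type} [Fintype α] [DecidableEq α] [Fintype β] [DecidableEq β]
      (ω : Ω) : LOCC Ω α β
  | alice {α β : Type} [Fintype α] [DecidableEq α] [Fintype β] [DecidableEq β]
      (r : ℕ) (d : Fin r → ℕ) (K : (i : Fin r) → Matrix (Fin (d i)) α ℂ)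
      (complete : ∑ i, (K i)ᴴ * K i = 1)
      (next : (i : Fin r) → LOCC Ω (Fin (d i)) β) : LOCC Ω α β
  | bob {α β : Type} [Fintype α] [DecidableEq α] [Fintype β] [DecidableEq β]
      (r : ℕ) (d : Fin r → ℕ) (K : (i : Fin r) → Matrix (Fin (d i)) β ℂ)
      (complete : ∑ i, (K i)ᴴ * K i = 1)
      (next : (i : Fin r) → LOCC Ω α (Fin (d i))) : LOCC Ω α β

/-- The effect of the output `ω` of an LOCC protocol: on the joint state `ρ` the protocol
outputs `ω` with probability `prob ρ (P.effect ω)`. -/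
def LOCC.effect {Ω : Type} : {α β : Type} → [Fintype α] → [DecidableEq α] →
    [Fintype β] → [DecidableEq β] → LOCC Ω α β → Ω → Matrix (α × β) (α × β) ℂ
  | α, β, _, _, _, _, @LOCC.output _ _ _ _ _ _ _ ω', ω =>
      haveI := Classical.propDecidable (ω' = ω)
      if ω' = ω then (1 : Matrix (α × β) (α × β) ℂ) else 0
  | _, β, _, _, _, _, @LOCC.alice _ _ _ _ _ _ _ _ _ K _ next, ω =>
      ∑ i, (K i ⊗ₖ (1 : Matrix β β ℂ))ᴴ * (next i).effect ω * (K i ⊗ₖ (1 : Matrix β β ℂ))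
  | α, _, _, _, _, _, @LOCC.bob _ _ _ _ _ _ _ _ _ K _ next, ω =>
      ∑ i, ((1 : Matrix α α ℂ) ⊗ₖ K i)ᴴ * (next i).effect ω * ((1 : Matrix α α ℂ) ⊗ₖ K i)

/-- For a sequence `s` of `n` distinct indices, the state `φ_{s 0} ⊗ ⋯ ⊗ φ_{s (n-1)}` of one
party holding `n` systems. -/
def localSeqState {ι α : Type} {n : ℕ} (φ : ι → α → ℂ) (s : Fin n ↪ ι) :
    Matrix (Fin n → α) (Fin n → α) ℂ :=
  pureState fun a => ∏ k, φ (s k) (a k)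

/-- For a sequence `s` of `n` distinct indices, the state `ψ_{s 0} ⊗ ⋯ ⊗ ψ_{s (n-1)}` of bipartite
states, as a state in the cut `A₁⋯Aₙ | B₁⋯Bₙ`. -/
def seqState {ι α β : Type} {n : ℕ} (ψ : ι → α × β → ℂ) (s : Fin n ↪ ι) :
    Matrix ((Fin n → α) × (Fin n → β)) ((Fin n → α) × (Fin n → β)) ℂ :=
  pureState fun p => ∏ k, ψ (s k) (p.1 k, p.2 k)

/-- `(n, m)`-LSAM: an LOCC protocol always outputs `m` distinct sequences, none of which is the
sequence that was distributed. -/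
def AdmitsLSAM {ι α β : Type} [Fintype α] [DecidableEq α] [Fintype β] [DecidableEq β]
    (ψ : ι → α × β → ℂ) (n m : ℕ) : Prop :=
  ∃ P : LOCC {X : Finset (Fin n ↪ ι) // X.card = m} (Fin n → α) (Fin n → β),
    ∀ X, ∀ s ∈ X.1, prob (seqState ψ s) (P.effect X) = 0

/-- Strong `(n, m)`-LSAM: in addition every sequence `s` is really excluded by some output, one
that occurs with positive probability on some sequence. For `m = 1` this is strong
antidistinguishability, by LOCC, of the set of all sequences. -/
def AdmitsStrongLSAM {ι α β : Type} [Fintype ι] [DecidableEq ι]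
    [Fintype α] [DecidableEq α] [Fintype β] [DecidableEq β]
    (ψ : ι → α × β → ℂ) (n m : ℕ) : Prop :=
  ∃ P : LOCC {X : Finset (Fin n ↪ ι) // X.card = m} (Fin n → α) (Fin n → β),
    (∀ X, ∀ s ∈ X.1, prob (seqState ψ s) (P.effect X) = 0) ∧
    (∀ s, ∃ X, s ∈ X.1 ∧ 0 < ∑ t, prob (seqState ψ t) (P.effect X))

/-- Conclusive identification of the states `ρ s`: the output `some s` never occurs on another
state and occurs on `ρ s` with positive probability; `none` is the inconclusive output. -/
def IsConclusive {H σ : Type} [Fintype H] (ρ : σ → Matrix H H ℂ)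
    (E : Option σ → Matrix H H ℂ) : Prop :=
  (∀ s t, t ≠ s → prob (ρ t) (E (some s)) = 0) ∧ (∀ s, 0 < prob (ρ s) (E (some s)))

/-- `n`-CLSM: the sequences of `n` distinct states can be conclusively identified by LOCC. -/
def AdmitsCLSM {ι α β : Type} [Fintype α] [DecidableEq α] [Fintype β] [DecidableEq β]
    (ψ : ι → α × β → ℂ) (n : ℕ) : Prop :=
  ∃ P : LOCC (Option (Fin n ↪ ι)) (Fin n → α) (Fin n → β), IsConclusive (seqState ψ) P.effect

/-- The sequences of `n` distinct states can be conclusively identified by a global measurement. -/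
def AdmitsGlobalCSM {ι α β : Type} [Fintype ι] [DecidableEq ι]
    [Fintype α] [DecidableEq α] [Fintype β] [DecidableEq β]
    (ψ : ι → α × β → ℂ) (n : ℕ) : Prop :=
  ∃ E : Option (Fin n ↪ ι) → Matrix ((Fin n → α) × (Fin n → β)) ((Fin n → α) × (Fin n → β)) ℂ,
    IsPOVM E ∧ IsConclusive (seqState ψ) E

def ketZero : Fin 2 → ℂ := ![1, 0]

def ketOne : Fin 2 → ℂ := ![0, 1]

def ketPlus : Fin 2 → ℂ := ((Real.sqrt 2 : ℝ) : ℂ)⁻¹ • (ketZero + ketOne)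

def ketIPlus : Fin 2 → ℂ := ((Real.sqrt 2 : ℝ) : ℂ)⁻¹ • (ketZero + Complex.I • ketOne)

def ketIMinus : Fin 2 → ℂ := ((Real.sqrt 2 : ℝ) : ℂ)⁻¹ • (ketZero - Complex.I • ketOne)

/-- Alice's parts of the Duan states. -/
def duanA : Fin 4 → Fin 2 → ℂ := ![ketZero, ketOne, ketPlus, ketIPlus]

/-- Bob's parts of the Duan states. -/
def duanB : Fin 4 → Fin 2 → ℂ := ![ketZero, ketOne, ketPlus, ketIMinus]

/-- The Duan states `|0⟩|0⟩`, `|1⟩|1⟩`, `|+⟩|+⟩`, `|i₊⟩|i₋⟩`, indexed by `0, 1, 2, 3`. -/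
def duan (i : Fin 4) : Fin 2 × Fin 2 → ℂ := fun p => duanA i p.1 * duanB i p.2

/-- The sequence `(i, j)` of two distinct indices. -/
def pair (i j : Fin 4) (h : i ≠ j) : Fin 2 ↪ Fin 4 :=
  ⟨![i, j], by
    intro a b hab
    fin_cases a <;> fin_cases b <;> simp_all [eq_comm]⟩

/-- With indices counted from 1, the four triples `{12, 21, 34}`, `{13, 23, 42}`, `{14, 24, 43}`,
`{41, 31, 32}` of sequences. -/
def duanTriple : Fin 4 → Fin 3 → (Fin 2 ↪ Fin 4) :=
  ![![pair 0 1 (by decide), pair 1 0 (by decide), pair 2 3 (by decide)],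
    ![pair 0 2 (by decide), pair 1 2 (by decide), pair 3 1 (by decide)],
    ![pair 0 3 (by decide), pair 1 3 (by decide), pair 3 2 (by decide)],
    ![pair 3 0 (by decide), pair 2 0 (by decide), pair 2 1 (by decide)]]

end Antimarking

end

/-! Every Duan state is a product whose Bob factor is the complex conjugate of Alice's, so
statements about one party pass to the other by transposition.

Antimarking needs only one party: if Alice's local sequences are antidistinguishable, she measures
and announces the excluded one (`admitsStrongLSAM_of_antidistinguishable`). Her twelve two-copy
states split into four triples, each antidistinguished by an adaptive product measurement, and
choosing the triple at random antidistinguishes all twelve. With one copy, effects annihilating |0⟩,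
|1⟩, |+⟩, |i₊⟩ have off-diagonal entries 0, 0, real and imaginary; these sum to zero, so the effect
for |+⟩ must vanish.

Global conclusive marking follows from linear independence: dual functionals of the Duan states
multiply to dual functionals of the sequences. Against LOCC, `LOCC.exists_product_functional`
follows one branch of positive probability and extracts f ⊗ g, nonzero on the sequence 01 (indices
from 0), with f or g vanishing on each other sequence. After conjugating g, both act on Alice's
states, and their coefficients cannot meet all these alternatives. -/

namespace Antimarking

open Matrix

/-! ### Born rule for pure states -/

section Born

variable {H H' : Type} [Fintype H] [Fintype H']

lemma prob_pureState (ψ : H → ℂ) (E : Matrix H H ℂ) :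
    prob (pureState ψ) E = (star ψ ⬝ᵥ E *ᵥ ψ).re := by
  rw [prob, pureState, vecMulVec_mul, trace_vecMulVec, dotProduct_comm, dotProduct_mulVec]

lemma prob_pureState_nonneg (ψ : H → ℂ) {E : Matrix H H ℂ} (hE : E.PosSemidef) :
    0 ≤ prob (pureState ψ) E := by
  rw [prob_pureState]
  exact (Complex.le_def.1 (hE.dotProduct_mulVec_nonneg ψ)).1

lemma ofReal_prob_pureState (ψ : H → ℂ) {E : Matrix H H ℂ} (hE : E.PosSemidef) :
    (prob (pureState ψ) E : ℂ) = star ψ ⬝ᵥ E *ᵥ ψ := by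
  rw [prob_pureState]
  exact Complex.ext rfl (Complex.le_def.1 (hE.dotProduct_mulVec_nonneg ψ)).2

/-- Positivity upgrades a vanishing expectation to a kernel vector, so exclusion conditions become
linear equations on the effect. -/
lemma mulVec_eq_zero_of_prob_eq_zero {ψ : H → ℂ} {E : Matrix H H ℂ} (hE : E.PosSemidef)
    (h : prob (pureState ψ) E = 0) : E *ᵥ ψ = 0 := by
  rw [← hE.dotProduct_mulVec_zero_iff, ← ofReal_prob_pureState ψ hE, h, Complex.ofReal_zero]

lemma prob_conjTranspose_mul_mul (ψ : H → ℂ) (K : Matrix H' H ℂ) (E : Matrix H' H' ℂ) :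
    prob (pureState ψ) (Kᴴ * E * K) = prob (pureState (K *ᵥ ψ)) E := by
  rw [prob_pureState, prob_pureState, ← mulVec_mulVec, ← mulVec_mulVec, dotProduct_mulVec,
    ← star_mulVec]

lemma prob_sum {κ : Type} (s : Finset κ) (ρ : Matrix H H ℂ) (E : κ → Matrix H H ℂ) :
    prob ρ (∑ k ∈ s, E k) = ∑ k ∈ s, prob ρ (E k) := by
  simp [prob, Finset.mul_sum, trace_sum]

lemma prob_smul (c : ℝ) (ρ E : Matrix H H ℂ) :
    prob ρ ((c : ℂ) • E) = c * prob ρ E := by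
  simp [prob]

lemma prob_zero (ρ : Matrix H H ℂ) : prob ρ 0 = 0 := by
  simp [prob]

lemma prob_transpose (ρ E : Matrix H H ℂ) : prob ρᵀ Eᵀ = prob ρ E := by
  rw [prob, prob, ← transpose_mul, trace_transpose, trace_mul_comm]

lemma prob_pureState_pureState (ψ χ : H → ℂ) :
    prob (pureState ψ) (pureState χ) = Complex.normSq (star χ ⬝ᵥ ψ) := by
  have h : star ψ ⬝ᵥ χ = star (star χ ⬝ᵥ ψ) := by
    rw [star_dotProduct]
  rw [prob_pureState, pureState, vecMulVec_mulVec, dotProduct_smul, h]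
  simp [Complex.normSq_apply]

lemma posSemidef_pureState (ψ : H → ℂ) : (pureState ψ).PosSemidef :=
  posSemidef_vecMulVec_self_star ψ

lemma pureState_star {H : Type} (ψ : H → ℂ) : pureState (star ψ) = (pureState ψ)ᵀ := by
  ext a b
  simp [pureState, vecMulVec_apply, mul_comm]

/-- By Cauchy–Schwarz, `|ψ⟩⟨ψ|` is bounded by `⟨ψ|ψ⟩`. -/
lemma prob_pureState_le [DecidableEq H] (ψ χ : H → ℂ) :
    prob (pureState χ) (pureState ψ) ≤ (star ψ ⬝ᵥ ψ).re * (star χ ⬝ᵥ χ).re := by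
  have h := inner_mul_inner_self_le (𝕜 := ℂ) (WithLp.toLp 2 ψ) (WithLp.toLp 2 χ)
  rw [norm_inner_symm (WithLp.toLp 2 χ), ← sq, ← RCLike.normSq_eq_def'] at h
  simp only [EuclideanSpace.inner_eq_star_dotProduct] at h
  rw [prob_pureState_pureState, dotProduct_comm, dotProduct_comm (star ψ),
    dotProduct_comm (star χ)]
  exact h

end Born

/-! ### Antidistinguishability under transposition and mixing -/

section Antidistinguishability

variable {H σ : Type} [Fintype H] [DecidableEq H] [Fintype σ]

lemma Antidistinguishable.transpose {ρ : σ → Matrix H H ℂ} (h : Antidistinguishable ρ) :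
    Antidistinguishable fun j => (ρ j)ᵀ := by
  obtain ⟨E, ⟨hE, hsum⟩, h0, hpos⟩ := h
  refine ⟨fun j => (E j)ᵀ, ⟨fun j => (hE j).transpose, ?_⟩, fun j => ?_, fun j => ?_⟩
  · rw [← transpose_sum, hsum, transpose_one]
  · rw [prob_transpose, h0]
  · simpa only [prob_transpose] using hpos j

/-- A set of pure states that is partitioned into antidistinguishable sets of equal size is
antidistinguishable. -/
lemma antidistinguishable_of_partition {κ τ : Type} [Fintype κ] [Nonempty κ] [Fintype τ]
    (ψ : σ → H → ℂ) (e : κ × τ ≃ σ)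
    (h : ∀ k, Antidistinguishable fun l => pureState (ψ (e (k, l)))) :
    Antidistinguishable fun s => pureState (ψ s) := by
  choose E hE h0 hpos using h
  have hc : (0 : ℝ) < (Fintype.card κ : ℝ)⁻¹ := by
    have : 0 < Fintype.card κ := Fintype.card_pos
    positivity
  set c : ℝ := (Fintype.card κ : ℝ)⁻¹ with hcdef
  have hE' : ∀ k l, ((c : ℂ) • E k l).PosSemidef := fun k l =>
    ((hE k).1 l).smul (by exact_mod_cast hc.le)
  -- Pick a block uniformly at random and use its POVM, hence the weight 1/|κ|.
  refine ⟨fun s => (c : ℂ) • E (e.symm s).1 (e.symm s).2, ⟨fun s => hE' _ _, ?_⟩,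
    fun s => ?_, fun s => ?_⟩
  · rw [← e.sum_comp]
    simp only [Equiv.symm_apply_apply]
    rw [Fintype.sum_prod_type]
    simp only [← Finset.smul_sum, (hE _).2]
    rw [Finset.sum_const, Finset.card_univ, smul_comm, ← Nat.cast_smul_eq_nsmul ℂ, smul_smul,
      hcdef]
    have : (Fintype.card κ : ℂ) ≠ 0 := by exact_mod_cast Fintype.card_ne_zero
    simp [this]
  · rw [prob_smul]
    have := h0 (e.symm s).1 (e.symm s).2
    simp only [Prod.mk.eta, Equiv.apply_symm_apply] at this
    rw [this, mul_zero]
  · rw [← e.sum_comp, Fintype.sum_prod_type]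
    refine lt_of_lt_of_le ?_ (Finset.single_le_sum
      (f := fun k => ∑ l, prob (pureState (ψ (e (k, l)))) ((c : ℂ) • E (e.symm s).1 (e.symm s).2))
      (fun k _ => Finset.sum_nonneg fun l _ => prob_pureState_nonneg _ (hE' _ _))
      (Finset.mem_univ (e.symm s).1))
    simp only [prob_smul, ← Finset.mul_sum]
    exact mul_pos hc (hpos _ _)

end Antidistinguishability

/-! ### LOCC protocols on product vectors -/

section Protocols

variable {Ω α β : Type} [Fintype α] [Fintype β]

/-- The product vector `x ⊗ y`. -/
def prodVec {α β : Type} (x : α → ℂ) (y : β → ℂ) : α × β → ℂ := fun p => x p.1 * y p.2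

lemma kronecker_mulVec_prodVec {α' β' : Type} (K : Matrix α' α ℂ) (L : Matrix β' β ℂ) (x : α → ℂ) (y : β → ℂ) :
    (K ⊗ₖ L) *ᵥ prodVec x y = prodVec (K *ᵥ x) (L *ᵥ y) := by
  ext ⟨a, b⟩
  simp only [mulVec, dotProduct, prodVec, kroneckerMap_apply, Fintype.sum_prod_type,
    Finset.sum_mul_sum]
  exact Finset.sum_congr rfl fun i _ => Finset.sum_congr rfl fun j _ => by ring

lemma star_prodVec {α β : Type} (x : α → ℂ) (y : β → ℂ) :
    star (prodVec x y) = prodVec (star x) (star y) := by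
  ext p
  simp [prodVec]

lemma prodVec_dotProduct_prodVec (x x' : α → ℂ) (y y' : β → ℂ) :
    prodVec x y ⬝ᵥ prodVec x' y' = (x ⬝ᵥ x') * (y ⬝ᵥ y') := by
  simp only [dotProduct, prodVec, Fintype.sum_prod_type, Finset.sum_mul_sum]
  exact Finset.sum_congr rfl fun i _ => Finset.sum_congr rfl fun j _ => by ring

variable [DecidableEq α] [DecidableEq β]

lemma LOCC.posSemidef_effect (P : LOCC Ω α β) (ω : Ω) : (P.effect ω).PosSemidef := by
  induction P with
  | output ω' =>
    rw [LOCC.effect]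
    split_ifs
    exacts [PosSemidef.one, PosSemidef.zero]
  | alice r d K hK next ih =>
    rw [LOCC.effect]
    exact posSemidef_sum _ fun i _ => (ih i).conjTranspose_mul_mul_same _
  | bob r d K hK next ih =>
    rw [LOCC.effect]
    exact posSemidef_sum _ fun i _ => (ih i).conjTranspose_mul_mul_same _

/-- Local Kraus operators keep product vectors product, so each branch continues with an
unnormalized product input. -/
lemma LOCC.prob_effect_alice (r : ℕ) (d : Fin r → ℕ) (K : (i : Fin r) → Matrix (Fin (d i)) α ℂ)
    (hK : ∑ i, (K i)ᴴ * K i = 1) (next : (i : Fin r) → LOCC Ω (Fin (d i)) β) (ω : Ω)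
    (x : α → ℂ) (y : β → ℂ) :
    prob (pureState (prodVec x y)) ((LOCC.alice r d K hK next).effect ω) =
      ∑ i, prob (pureState (prodVec (K i *ᵥ x) y)) ((next i).effect ω) := by
  rw [LOCC.effect, prob_sum]
  simp only [prob_conjTranspose_mul_mul, kronecker_mulVec_prodVec, one_mulVec]

lemma LOCC.prob_effect_bob (r : ℕ) (d : Fin r → ℕ) (K : (i : Fin r) → Matrix (Fin (d i)) β ℂ)
    (hK : ∑ i, (K i)ᴴ * K i = 1) (next : (i : Fin r) → LOCC Ω α (Fin (d i))) (ω : Ω)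
    (x : α → ℂ) (y : β → ℂ) :
    prob (pureState (prodVec x y)) ((LOCC.bob r d K hK next).effect ω) =
      ∑ i, prob (pureState (prodVec x (K i *ᵥ y))) ((next i).effect ω) := by
  rw [LOCC.effect, prob_sum]
  simp only [prob_conjTranspose_mul_mul, kronecker_mulVec_prodVec, one_mulVec]

lemma LOCC.prob_effect_output (ω' ω : Ω) [Decidable (ω' = ω)] (x : α → ℂ) (y : β → ℂ) :
    prob (pureState (prodVec x y)) ((LOCC.output ω' : LOCC Ω α β).effect ω) =
      if ω' = ω then ((star x ⬝ᵥ x) * (star y ⬝ᵥ y)).re else 0 := by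
  rw [LOCC.effect]
  split_ifs
  · rw [prob_pureState, one_mulVec, star_prodVec, prodVec_dotProduct_prodVec]
  · rw [prob_zero]

/-- If an output of an LOCC protocol identifies `x s ⊗ y s` conclusively among product vectors
`x t ⊗ y t`, then so does a product functional `f ⊗ g`. -/
theorem LOCC.exists_product_functional {σ : Type} (P : LOCC Ω α β) (ω : Ω) (x : σ → α → ℂ)
    (y : σ → β → ℂ) (s : σ)
    (h0 : ∀ t, t ≠ s → prob (pureState (prodVec (x t) (y t))) (P.effect ω) = 0)
    (hs : 0 < prob (pureState (prodVec (x s) (y s))) (P.effect ω)) :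
    ∃ (f : α → ℂ) (g : β → ℂ), f ⬝ᵥ x s ≠ 0 ∧ g ⬝ᵥ y s ≠ 0 ∧
      ∀ t, t ≠ s → f ⬝ᵥ x t = 0 ∨ g ⬝ᵥ y t = 0 := by
  induction P with
  | output ω' =>
    classical
    simp only [LOCC.prob_effect_output] at h0 hs
    split_ifs at h0 hs with hω
    · refine ⟨star (x s), star (y s), fun h => ?_, fun h => ?_, fun t ht => ?_⟩
      · simp [h] at hs
      · simp [h] at hs
      -- This output has probability ‖x t‖²‖y t‖² on `t`; if that is zero, one of the factors is the
      -- zero vector.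
      · have hx := dotProduct_star_self_nonneg (x t)
        have hy := dotProduct_star_self_nonneg (y t)
        have h : (star (x t) ⬝ᵥ x t) * (star (y t) ⬝ᵥ y t) = 0 :=
          Complex.ext (h0 t ht) (Complex.le_def.1 (mul_nonneg hx hy)).2.symm
        rcases mul_eq_zero.1 h with h | h
        · exact Or.inl (by rw [dotProduct_star_self_eq_zero.1 h, dotProduct_zero])
        · exact Or.inr (by rw [dotProduct_star_self_eq_zero.1 h, dotProduct_zero])
    · exact absurd hs (lt_irrefl 0)
  | alice r d K hK next ih =>
    simp only [LOCC.prob_effect_alice] at h0 hs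
    -- Some branch is positive on `s`; since all branches are nonnegative, it is zero on the other
    -- inputs. Its functional pulls back along `K i`.
    obtain ⟨i, -, hi⟩ := Finset.exists_lt_of_sum_lt (s := Finset.univ) (f := fun _ => (0 : ℝ))
      (by simpa using hs)
    obtain ⟨f, g, hf, hg, hfg⟩ := ih i (fun t => K i *ᵥ x t) y
      (fun t ht => (Finset.sum_eq_zero_iff_of_nonneg fun j _ =>
        prob_pureState_nonneg _ ((next j).posSemidef_effect ω)).1 (h0 t ht) i (Finset.mem_univ i))
      hi
    simp only [dotProduct_mulVec] at hf hfg
    exact ⟨f ᵥ* K i, g, hf, hg, hfg⟩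
  | bob r d K hK next ih =>
    simp only [LOCC.prob_effect_bob] at h0 hs
    obtain ⟨i, -, hi⟩ := Finset.exists_lt_of_sum_lt (s := Finset.univ) (f := fun _ => (0 : ℝ))
      (by simpa using hs)
    obtain ⟨f, g, hf, hg, hfg⟩ := ih i x (fun t => K i *ᵥ y t)
      (fun t ht => (Finset.sum_eq_zero_iff_of_nonneg fun j _ =>
        prob_pureState_nonneg _ ((next j).posSemidef_effect ω)).1 (h0 t ht) i (Finset.mem_univ i))
      hi
    simp only [dotProduct_mulVec] at hg hfg
    exact ⟨f, g ᵥ* K i, hf, hg, hfg⟩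

end Protocols

/-! ### Sequences of states: antimarking and global conclusive marking -/

section Sequences

variable {ι α β : Type} {n : ℕ}

/-- The vector `φ_{s 0} ⊗ ⋯ ⊗ φ_{s (n-1)}`. -/
def seqVec (φ : ι → α → ℂ) (s : Fin n ↪ ι) : (Fin n → α) → ℂ := fun a => ∏ k, φ (s k) (a k)

lemma localSeqState_eq (φ : ι → α → ℂ) (s : Fin n ↪ ι) :
    localSeqState φ s = pureState (seqVec φ s) := rfl

lemma seqState_eq (φ : ι → α → ℂ) (χ : ι → β → ℂ) (s : Fin n ↪ ι) :
    seqState (fun i p => φ i p.1 * χ i p.2) s = pureState (prodVec (seqVec φ s) (seqVec χ s)) := by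
  simp only [seqState, Finset.prod_mul_distrib]
  rfl

lemma star_seqVec (φ : ι → α → ℂ) (s : Fin n ↪ ι) :
    star (seqVec φ s) = seqVec (fun i => star (φ i)) s := by
  ext a
  simp [seqVec]

lemma seqVec_dotProduct [Fintype α] [DecidableEq α] (φ χ : ι → α → ℂ) (s t : Fin n ↪ ι) :
    seqVec φ s ⬝ᵥ seqVec χ t = ∏ k, φ (s k) ⬝ᵥ χ (t k) := by
  simp only [dotProduct, seqVec, Finset.prod_univ_sum, Fintype.piFinset_univ,
    Finset.prod_mul_distrib]

lemma star_seqVec_dotProduct_self [Fintype α] [DecidableEq α] (φ : ι → α → ℂ)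
    (hφ : ∀ i, star (φ i) ⬝ᵥ φ i = 1) (s : Fin n ↪ ι) :
    star (seqVec φ s) ⬝ᵥ seqVec φ s = 1 := by
  rw [star_seqVec, seqVec_dotProduct]
  simp [hφ]

variable [Fintype ι] [DecidableEq ι] [Fintype α] [DecidableEq α] [Fintype β] [DecidableEq β]

open scoped MatrixOrder in
/-- If one party can antidistinguish her local sequences, then the two parties can antimark. -/
theorem admitsStrongLSAM_of_antidistinguishable (φ : ι → α → ℂ) (χ : ι → β → ℂ)
    (hχ : ∀ i, star (χ i) ⬝ᵥ χ i = 1)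
    (h : Antidistinguishable fun s : Fin n ↪ ι => localSeqState φ s) :
    AdmitsStrongLSAM (fun i (p : α × β) => φ i p.1 * χ i p.2) n 1 := by
  obtain ⟨E, ⟨hE, hsum⟩, h0, hpos⟩ := h
  -- Factors B with BᴴB = E s serve as Kraus operators; `e` and `c` relabel outcomes and output
  -- space by `Fin`, as `LOCC` demands.
  have hB : ∀ s, ∃ B : Matrix (Fin n → α) (Fin n → α) ℂ, E s = Bᴴ * B := fun s =>
    CStarAlgebra.nonneg_iff_eq_star_mul_self.1 (hE s).nonneg
  choose B hB using hB
  let e := Fintype.equivFin (Fin n ↪ ι)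
  let c := Fintype.equivFin (Fin n → α)
  let K (i : Fin (Fintype.card (Fin n ↪ ι))) :
      Matrix (Fin (Fintype.card (Fin n → α))) (Fin n → α) ℂ := (B (e.symm i)).submatrix c.symm id
  have hK : ∀ i, (K i)ᴴ * K i = E (e.symm i) := fun i => by
    rw [hB]
    simp only [K, conjTranspose_submatrix]
    rw [submatrix_mul_equiv, submatrix_id_id]
  have hK1 : ∑ i, (K i)ᴴ * K i = 1 := by
    simp only [hK]
    rw [e.symm.sum_comp E, hsum]
  let P : LOCC {X : Finset (Fin n ↪ ι) // X.card = 1} (Fin n → α) (Fin n → β) :=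
    LOCC.alice _ (fun _ => Fintype.card (Fin n → α)) K hK1
      fun i => LOCC.output ⟨{e.symm i}, Finset.card_singleton _⟩
  have hP : ∀ s t, prob (seqState (fun i (p : α × β) => φ i p.1 * χ i p.2) t)
      (P.effect ⟨{s}, Finset.card_singleton _⟩) = prob (localSeqState φ t) (E s) := fun s t => by
    rw [seqState_eq, LOCC.prob_effect_alice]
    simp only [LOCC.prob_effect_output, Subtype.mk.injEq, Finset.singleton_inj,
      star_seqVec_dotProduct_self χ hχ, mul_one]
    rw [Finset.sum_eq_single (e s)]
    · rw [if_pos (e.symm_apply_apply s), localSeqState_eq, prob_pureState, star_mulVec,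
        ← dotProduct_mulVec, mulVec_mulVec, hK, e.symm_apply_apply]
    · intro i _ hi
      rw [if_neg]
      rintro rfl
      simp at hi
    · simp
  refine ⟨P, ?_, fun s => ⟨⟨{s}, Finset.card_singleton _⟩, Finset.mem_singleton_self s, ?_⟩⟩
  · rintro ⟨X, hX⟩ s hs
    obtain ⟨t, rfl⟩ := Finset.card_eq_one.1 hX
    obtain rfl := Finset.mem_singleton.1 hs
    rw [hP, h0]
  · simpa only [hP] using hpos s

lemma AdmitsStrongLSAM.admitsLSAM {ψ : ι → α × β → ℂ} {m : ℕ}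
    (h : AdmitsStrongLSAM ψ n m) : AdmitsLSAM ψ n m :=
  let ⟨P, hP, _⟩ := h
  ⟨P, hP⟩

/-- Vectors with a biorthogonal family of functionals can be identified conclusively. -/
lemma exists_conclusive_of_dual {H σ : Type} [Fintype H] [DecidableEq H] [Fintype σ]
    (ψ G : σ → H → ℂ) (h0 : ∀ s t, t ≠ s → G s ⬝ᵥ ψ t = 0) (h1 : ∀ s, G s ⬝ᵥ ψ s ≠ 0) :
    ∃ E : Option σ → Matrix H H ℂ, IsPOVM E ∧ IsConclusive (fun s => pureState (ψ s)) E := by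
  -- By Cauchy–Schwarz the projectors onto the conjugated functionals sum to at most N, so scaling
  -- by 1/(1+N) leaves a positive remainder for `none`; the 1 keeps the denominator positive.
  let N : ℝ := ∑ s, (star (G s) ⬝ᵥ G s).re
  have hN : 0 ≤ N := Finset.sum_nonneg fun s _ =>
    (Complex.le_def.1 (dotProduct_star_self_nonneg (G s))).1
  have hc : 0 < (1 + N)⁻¹ := by positivity
  set c : ℝ := (1 + N)⁻¹ with hcdef
  let F (s : σ) : Matrix H H ℂ := (c : ℂ) • pureState (star (G s))
  have hF : ∀ s, (F s).PosSemidef := fun s =>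
    (posSemidef_pureState _).smul (by exact_mod_cast hc.le)
  have hprob : ∀ s t, prob (pureState (ψ t)) (F s) = c * Complex.normSq (G s ⬝ᵥ ψ t) :=
    fun s t => by rw [prob_smul, prob_pureState_pureState, star_star]
  refine ⟨fun o => o.elim (1 - ∑ s, F s) F, ⟨?_, ?_⟩, fun s t hts => ?_, fun s => ?_⟩
  · rintro (_ | s)
    · have hH : (∑ s, F s).PosSemidef := posSemidef_sum _ fun s _ => hF s
      refine PosSemidef.of_dotProduct_mulVec_nonneg (isHermitian_one.sub hH.isHermitian) fun v => ?_
      have hv := dotProduct_star_self_nonneg v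
      change 0 ≤ star v ⬝ᵥ (1 - ∑ s, F s) *ᵥ v
      rw [sub_mulVec, one_mulVec, dotProduct_sub, ← ofReal_prob_pureState v hH, prob_sum]
      have hv' : ((star v ⬝ᵥ v).re : ℂ) = star v ⬝ᵥ v :=
        Complex.ext rfl (Complex.le_def.1 hv).2
      rw [← hv', ← Complex.ofReal_sub]
      have hle : ∑ s, prob (pureState v) (F s) ≤ c * (N * (star v ⬝ᵥ v).re) := by
        simp only [F, prob_smul, ← Finset.mul_sum, N, Finset.sum_mul]
        gcongr with s
        simpa [dotProduct_comm] using prob_pureState_le (star (G s)) v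
      have hcN : c * N ≤ 1 := by
        rw [hcdef, inv_mul_le_iff₀ (by positivity)]
        linarith
      have hv0 : 0 ≤ (star v ⬝ᵥ v).re := (Complex.le_def.1 hv).1
      have : 0 ≤ (star v ⬝ᵥ v).re - ∑ s, prob (pureState v) (F s) := by
        nlinarith [mul_le_mul_of_nonneg_right hcN hv0]
      exact_mod_cast this
    · exact hF s
  · simp [Fintype.sum_option]
  · simp [hprob, h0 s t hts]
  · have := Complex.normSq_pos.2 (h1 s)
    change 0 < prob (pureState (ψ s)) (F s)
    rw [hprob]
    positivity

/-- The sequences of linearly independent states, the independence being witnessed by a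
biorthogonal family, can be identified conclusively by a global measurement. -/
theorem admitsGlobalCSM_of_dual (ψ G : ι → α × β → ℂ) (h0 : ∀ i j, j ≠ i → G i ⬝ᵥ ψ j = 0)
    (h1 : ∀ i, G i ⬝ᵥ ψ i ≠ 0) : AdmitsGlobalCSM ψ n := by
  have hdot : ∀ s t : Fin n ↪ ι,
      (fun p : (Fin n → α) × (Fin n → β) => ∏ k, G (s k) (p.1 k, p.2 k)) ⬝ᵥ
        (fun p => ∏ k, ψ (t k) (p.1 k, p.2 k)) = ∏ k, G (s k) ⬝ᵥ ψ (t k) := fun s t => by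
    rw [← seqVec_dotProduct, dotProduct, dotProduct,
      ← (Equiv.arrowProdEquivProdArrow (Fin n) (fun _ => α) (fun _ => β)).sum_comp]
    rfl
  refine exists_conclusive_of_dual
    (fun (s : Fin n ↪ ι) (p : (Fin n → α) × (Fin n → β)) => ∏ k, ψ (s k) (p.1 k, p.2 k))
    (fun s p => ∏ k, G (s k) (p.1 k, p.2 k)) (fun s t hts => ?_) fun s => ?_
  · obtain ⟨k, hk⟩ : ∃ k, t k ≠ s k := by
      by_contra! hk
      exact hts (DFunLike.ext _ _ hk)
    rw [hdot]
    exact Finset.prod_eq_zero (Finset.mem_univ k) (h0 _ _ hk)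
  · rw [hdot]
    exact Finset.prod_ne_zero_iff.2 fun k _ => h1 _

end Sequences

/-! ### Product effects on two systems of one party -/

section TwoSystems

variable {ι α : Type}

/-- The operator `P ⊗ Q` on two systems held by one party. -/
def tensorOp (P Q : Matrix α α ℂ) : Matrix (Fin 2 → α) (Fin 2 → α) ℂ :=
  (P ⊗ₖ Q).submatrix (finTwoArrowEquiv α) (finTwoArrowEquiv α)

lemma tensorOp_add_left (P P' Q : Matrix α α ℂ) :
    tensorOp (P + P') Q = tensorOp P Q + tensorOp P' Q := by
  ext a b
  simp [tensorOp, add_mul]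

lemma tensorOp_add_right (P Q Q' : Matrix α α ℂ) :
    tensorOp P (Q + Q') = tensorOp P Q + tensorOp P Q' := by
  ext a b
  simp [tensorOp, mul_add]

lemma tensorOp_one [DecidableEq α] : tensorOp (1 : Matrix α α ℂ) 1 = 1 := by
  rw [tensorOp, one_kronecker_one, submatrix_one_equiv]

variable [Fintype α]

lemma posSemidef_tensorOp {P Q : Matrix α α ℂ} (hP : P.PosSemidef) (hQ : Q.PosSemidef) :
    (tensorOp P Q).PosSemidef :=
  (hP.kronecker hQ).submatrix _

lemma seqVec_two {α : Type} (φ : ι → α → ℂ) (s : Fin 2 ↪ ι) :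
    seqVec φ s = prodVec (φ (s 0)) (φ (s 1)) ∘ finTwoArrowEquiv α := by
  ext a
  simp [seqVec, prodVec]

lemma prob_localSeqState_tensorOp (φ : ι → α → ℂ) (s : Fin 2 ↪ ι) {P Q : Matrix α α ℂ}
    (hP : P.PosSemidef) (hQ : Q.PosSemidef) :
    prob (localSeqState φ s) (tensorOp P Q) =
      prob (pureState (φ (s 0))) P * prob (pureState (φ (s 1))) Q := by
  -- `prob` is a real part, which is not multiplicative; positivity makes the expectations real, so
  -- the product can be computed in ℂ.
  rw [localSeqState_eq, ← Complex.ofReal_inj, Complex.ofReal_mul,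
    ofReal_prob_pureState _ (posSemidef_tensorOp hP hQ), ofReal_prob_pureState _ hP,
    ofReal_prob_pureState _ hQ, seqVec_two, tensorOp, submatrix_mulVec_equiv, Function.comp_assoc,
    Equiv.self_comp_symm, Function.comp_id, kronecker_mulVec_prodVec,
    ← prodVec_dotProduct_prodVec, ← star_prodVec]
  exact comp_equiv_dotProduct_comp_equiv (star (prodVec _ _)) (prodVec _ _) (finTwoArrowEquiv α)

/-- A functional on two systems, evaluated on a product vector. -/
lemma dotProduct_seqVec_two (f : (Fin 2 → α) → ℂ) (φ : ι → α → ℂ) (s : Fin 2 ↪ ι) :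
    f ⬝ᵥ seqVec φ s = ∑ a, ∑ b, f ![a, b] * (φ (s 0) a * φ (s 1) b) := by
  rw [seqVec_two, dotProduct, ← (finTwoArrowEquiv α).symm.sum_comp, Fintype.sum_prod_type]
  simp [prodVec]

end TwoSystems

/-! ### Qubit bases and transition probabilities -/

section Kets

/-- The vector `|-⟩`. -/
noncomputable def ketMinus : Fin 2 → ℂ := ((Real.sqrt 2 : ℝ) : ℂ)⁻¹ • (ketZero - ketOne)

lemma inv_sqrt_two_mul_self :
    ((Real.sqrt 2 : ℝ) : ℂ)⁻¹ * ((Real.sqrt 2 : ℝ) : ℂ)⁻¹ = 1 / 2 := by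
  rw [← mul_inv, ← Complex.ofReal_mul, Real.mul_self_sqrt (by norm_num)]
  norm_num

lemma inv_sqrt_two_ne_zero : ((Real.sqrt 2 : ℝ) : ℂ)⁻¹ ≠ 0 := by
  simp

lemma prob_pureState_qubit (ψ χ : Fin 2 → ℂ) : prob (pureState ψ) (pureState χ) =
    Complex.normSq (star (χ 0) * ψ 0 + star (χ 1) * ψ 1) := by
  rw [prob_pureState_pureState, dotProduct, Fin.sum_univ_two]
  rfl

lemma pureState_smul (c : ℂ) (ψ : Fin 2 → ℂ) :
    pureState (c • ψ) = ((Complex.normSq c : ℝ) : ℂ) • pureState ψ := by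
  ext a b
  simp [pureState, vecMulVec_apply, Complex.normSq_eq_conj_mul_self]
  ring

lemma normSq_inv_sqrt_two : Complex.normSq ((Real.sqrt 2 : ℝ) : ℂ)⁻¹ = 1 / 2 := by
  simp

lemma pureState_apply {H : Type} (ψ : H → ℂ) (a b : H) : pureState ψ a b = ψ a * star (ψ b) :=
  rfl

lemma pureState_ketZero_add_ketOne : pureState ketZero + pureState ketOne = 1 := by
  ext a b
  fin_cases a <;> fin_cases b <;> simp [Matrix.add_apply, pureState_apply, ketZero, ketOne]

lemma pureState_ketPlus_add_ketMinus : pureState ketPlus + pureState ketMinus = 1 := by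
  rw [ketPlus, ketMinus, pureState_smul, pureState_smul, normSq_inv_sqrt_two]
  ext a b
  fin_cases a <;> fin_cases b <;>
    simp [Matrix.add_apply, Matrix.smul_apply, pureState_apply, ketZero, ketOne] <;> norm_num

lemma pureState_ketIPlus_add_ketIMinus : pureState ketIPlus + pureState ketIMinus = 1 := by
  rw [ketIPlus, ketIMinus, pureState_smul, pureState_smul, normSq_inv_sqrt_two]
  ext a b
  fin_cases a <;> fin_cases b <;>
    simp [Matrix.add_apply, Matrix.smul_apply, pureState_apply, ketZero, ketOne] <;> norm_num

/-- The transition probabilities of the states of one party to the vectors `|0⟩`, `|1⟩`, `|+⟩`,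
`|-⟩`, `|i₊⟩`, `|i₋⟩`. -/
lemma prob_duanA (i : Fin 4) (m : Fin 6) :
    prob (pureState (duanA i))
      (pureState (![ketZero, ketOne, ketPlus, ketMinus, ketIPlus, ketIMinus] m)) =
    !![1, 0, 1 / 2, 1 / 2, 1 / 2, 1 / 2;
       0, 1, 1 / 2, 1 / 2, 1 / 2, 1 / 2;
       1 / 2, 1 / 2, 1, 0, 1 / 2, 1 / 2;
       1 / 2, 1 / 2, 1 / 2, 1 / 2, 1, 0] i m := by
  have h : Real.sqrt 2 / 2 * (Real.sqrt 2 / 2) = 1 / 2 := by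
    rw [div_mul_div_comm, Real.mul_self_sqrt (by norm_num)]
    norm_num
  fin_cases i <;> fin_cases m <;>
    simp [duanA, ketPlus, ketMinus, ketIPlus, ketIMinus, prob_pureState_qubit, ketZero, ketOne,
      Complex.normSq_apply] <;>
    norm_num [h]

end Kets

/-! ### The four triples and the conjugation between the parties -/

section Triples

lemma pair_apply_zero (i j : Fin 4) (h : i ≠ j) : pair i j h 0 = i := rfl

lemma pair_apply_one (i j : Fin 4) (h : i ≠ j) : pair i j h 1 = j := rfl

lemma duanTriple_injective (k : Fin 4) : Function.Injective (duanTriple k) := by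
  revert k
  decide

lemma exists_duanTriple_eq (s : Fin 2 ↪ Fin 4) : ∃ k l, duanTriple k l = s := by
  have key : ∀ i j : Fin 4, i ≠ j → ∃ k l, duanTriple k l 0 = i ∧ duanTriple k l 1 = j := by
    decide
  obtain ⟨k, l, h0, h1⟩ := key (s 0) (s 1) fun h => absurd (s.injective h) (by decide)
  refine ⟨k, l, DFunLike.ext _ _ fun x => ?_⟩
  fin_cases x
  exacts [h0, h1]

/-- The partition of the sequences of two distinct indices into four triples. -/
noncomputable def duanTripleEquiv : Fin 4 × Fin 3 ≃ (Fin 2 ↪ Fin 4) :=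
  Equiv.ofBijective (fun p => duanTriple p.1 p.2) <| by
    rw [Fintype.bijective_iff_surjective_and_card]
    refine ⟨fun s => ?_, ?_⟩
    · obtain ⟨k, l, h⟩ := exists_duanTriple_eq s
      exact ⟨(k, l), h⟩
    · rw [Fintype.card_embedding_eq]
      rfl

/-- Conjugation fixes |0⟩, |1⟩, |+⟩ and swaps |i₊⟩ with |i₋⟩. -/
lemma star_duanA (i : Fin 4) : star (duanA i) = duanB i := by
  ext a
  fin_cases i <;> fin_cases a <;>
    simp [duanA, duanB, ketZero, ketOne, ketPlus, ketIPlus, ketIMinus]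

lemma star_duanB_dotProduct_self (i : Fin 4) : star (duanB i) ⬝ᵥ duanB i = 1 := by
  have h := inv_sqrt_two_mul_self
  fin_cases i <;>
    simp [duanB, ketZero, ketOne, ketPlus, ketIMinus, dotProduct, Fin.sum_univ_two]
  · linear_combination 2 * h
  · linear_combination 2 * h - ((Real.sqrt 2 : ℝ) : ℂ)⁻¹ ^ 2 * Complex.I_sq

lemma seqVec_duanB (s : Fin 2 ↪ Fin 4) : seqVec duanB s = star (seqVec duanA s) := by
  rw [star_seqVec]
  simp only [star_duanA]

lemma localSeqState_duanB (s : Fin 2 ↪ Fin 4) :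
    localSeqState duanB s = (localSeqState duanA s)ᵀ := by
  rw [localSeqState_eq, localSeqState_eq, seqVec_duanB, pureState_star]

end Triples

/-! ### Local antidistinguishability of the Duan states -/

section Antidistinguishability

lemma prob_duanA_one (i : Fin 4) : prob (pureState (duanA i)) 1 = 1 := by
  rw [prob_pureState, one_mulVec, star_duanA, dotProduct_comm, ← star_star (duanA i), star_duanA,
    star_duanB_dotProduct_self, Complex.one_re]

/-- Each triple is antidistinguished by product effects: the first measured system excludes one
state or leads to a measurement of the other system, which excludes one of the others. -/
theorem antidistinguishable_duanTriple (k : Fin 4) :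
    Antidistinguishable fun l => localSeqState duanA (duanTriple k l) := by
  have h0 := posSemidef_pureState ketZero
  have h1 := posSemidef_pureState ketOne
  have hp := posSemidef_pureState ketPlus
  have hm := posSemidef_pureState ketMinus
  have hip := posSemidef_pureState ketIPlus
  have him := posSemidef_pureState ketIMinus
  have h : (1 : Matrix (Fin 2) (Fin 2) ℂ).PosSemidef := PosSemidef.one
  have t0 := fun i => prob_duanA i 0
  have t1 := fun i => prob_duanA i 1
  have tp := fun i => prob_duanA i 2
  have tm := fun i => prob_duanA i 3
  have tip := fun i => prob_duanA i 4
  have tim := fun i => prob_duanA i 5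
  simp only [cons_val] at t0 t1 tp tm tip tim
  fin_cases k
  -- |−⟩ on the first system rules out 23; after |+⟩, the second system in the basis |0⟩, |1⟩ rules
  -- out 01 or 10. The other triples work likewise, the second system being measured first in the
  -- middle two.
  · refine ⟨![tensorOp (pureState ketPlus) (pureState ketZero),
      tensorOp (pureState ketPlus) (pureState ketOne), tensorOp (pureState ketMinus) 1],
      ⟨?_, ?_⟩, ?_, ?_⟩
    · simp [Fin.forall_fin_succ, posSemidef_tensorOp, *]
    · simp only [Fin.sum_univ_three, cons_val]
      rw [← tensorOp_add_right, pureState_ketZero_add_ketOne, ← tensorOp_add_left,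
        pureState_ketPlus_add_ketMinus, tensorOp_one]
    · simp [Fin.forall_fin_succ, prob_localSeqState_tensorOp, duanTriple, pair_apply_zero,
        pair_apply_one, prob_duanA_one, *]
    · simp [Fin.forall_fin_succ, Fin.sum_univ_three, prob_localSeqState_tensorOp, duanTriple,
        pair_apply_zero, pair_apply_one, prob_duanA_one, *]
  · refine ⟨![tensorOp (pureState ketOne) (pureState ketOne),
      tensorOp (pureState ketZero) (pureState ketOne), tensorOp 1 (pureState ketZero)],
      ⟨?_, ?_⟩, ?_, ?_⟩
    · simp [Fin.forall_fin_succ, posSemidef_tensorOp, *]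
    · simp only [Fin.sum_univ_three, cons_val]
      rw [← tensorOp_add_left, add_comm (pureState ketOne), pureState_ketZero_add_ketOne,
        ← tensorOp_add_right, add_comm (pureState ketOne), pureState_ketZero_add_ketOne,
        tensorOp_one]
    · simp [Fin.forall_fin_succ, prob_localSeqState_tensorOp, duanTriple, pair_apply_zero,
        pair_apply_one, prob_duanA_one, *]
    · simp [Fin.forall_fin_succ, Fin.sum_univ_three, prob_localSeqState_tensorOp, duanTriple,
        pair_apply_zero, pair_apply_one, prob_duanA_one, *]
  · refine ⟨![tensorOp (pureState ketOne) (pureState ketPlus),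
      tensorOp (pureState ketZero) (pureState ketPlus), tensorOp 1 (pureState ketMinus)],
      ⟨?_, ?_⟩, ?_, ?_⟩
    · simp [Fin.forall_fin_succ, posSemidef_tensorOp, *]
    · simp only [Fin.sum_univ_three, cons_val]
      rw [← tensorOp_add_left, add_comm (pureState ketOne), pureState_ketZero_add_ketOne,
        ← tensorOp_add_right, pureState_ketPlus_add_ketMinus, tensorOp_one]
    · simp [Fin.forall_fin_succ, prob_localSeqState_tensorOp, duanTriple, pair_apply_zero,
        pair_apply_one, prob_duanA_one, *]
    · simp [Fin.forall_fin_succ, Fin.sum_univ_three, prob_localSeqState_tensorOp, duanTriple,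
        pair_apply_zero, pair_apply_one, prob_duanA_one, *]
  · refine ⟨![tensorOp (pureState ketIMinus) 1,
      tensorOp (pureState ketIPlus) (pureState ketOne),
      tensorOp (pureState ketIPlus) (pureState ketZero)], ⟨?_, ?_⟩, ?_, ?_⟩
    · simp [Fin.forall_fin_succ, posSemidef_tensorOp, *]
    · simp only [Fin.sum_univ_three, cons_val]
      rw [add_assoc, ← tensorOp_add_right, add_comm (pureState ketOne),
        pureState_ketZero_add_ketOne, ← tensorOp_add_left, add_comm (pureState ketIMinus),
        pureState_ketIPlus_add_ketIMinus, tensorOp_one]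
    · simp [Fin.forall_fin_succ, prob_localSeqState_tensorOp, duanTriple, pair_apply_zero,
        pair_apply_one, prob_duanA_one, *]
    · simp [Fin.forall_fin_succ, Fin.sum_univ_three, prob_localSeqState_tensorOp, duanTriple,
        pair_apply_zero, pair_apply_one, prob_duanA_one, *]
      norm_num

theorem antidistinguishable_localSeqState_duanA :
    Antidistinguishable fun s : Fin 2 ↪ Fin 4 => localSeqState duanA s :=
  antidistinguishable_of_partition (seqVec duanA) duanTripleEquiv antidistinguishable_duanTriple

theorem not_antidistinguishable_duanA : ¬ Antidistinguishable fun i => pureState (duanA i) := by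
  rintro ⟨E, ⟨hE, hsum⟩, h0, hpos⟩
  have hz := fun i => mulVec_eq_zero_of_prob_eq_zero (hE i) (h0 i)
  have hr := inv_sqrt_two_ne_zero
  have e0 : E 0 1 0 = 0 := by
    simpa [mulVec, dotProduct, duanA, ketZero] using congrFun (hz 0) 1
  have e1 : E 1 0 1 = 0 := by
    simpa [mulVec, dotProduct, duanA, ketOne] using congrFun (hz 1) 0
  have e2 : ∀ a, E 2 a 0 + E 2 a 1 = 0 := fun a => by
    have := congrFun (hz 2) a
    simp only [mulVec, dotProduct, duanA, ketPlus, ketZero, ketOne, Fin.sum_univ_two, cons_val,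
      Pi.smul_apply, Pi.add_apply, smul_eq_mul, Pi.zero_apply] at this
    refine (mul_eq_zero.1 ?_).resolve_left hr
    linear_combination this
  have e3 : E 3 0 0 + Complex.I * E 3 0 1 = 0 := by
    have := congrFun (hz 3) 0
    simp only [mulVec, dotProduct, duanA, ketIPlus, ketZero, ketOne, Fin.sum_univ_two, cons_val,
      Pi.smul_apply, Pi.add_apply, smul_eq_mul, Pi.zero_apply] at this
    refine (mul_eq_zero.1 ?_).resolve_left hr
    linear_combination this
  have e0' : E 0 0 1 = 0 := by
    rw [← (hE 0).isHermitian.apply, e0, star_zero]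
  have hs : E 2 0 1 + E 3 0 1 = 0 := by
    have := congrFun (congrFun hsum 0) 1
    simpa [Fin.sum_univ_four, e0', e1] using this
  have hx := Complex.le_def.1 ((hE 2).diag_nonneg (i := 0))
  have hy := Complex.le_def.1 ((hE 3).diag_nonneg (i := 0))
  -- Diagonal entries of positive matrices are real, so this equates a real number with an imaginary
  -- one, and both vanish.
  have hxy : E 2 0 0 = Complex.I * E 3 0 0 := by
    linear_combination e2 0 - hs - Complex.I * e3 + E 3 0 1 * Complex.I_sq
  have e00 : E 2 0 0 = 0 := by
    refine Complex.ext ?_ hx.2.symm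
    have := congrArg Complex.re hxy
    simpa [← hy.2] using this
  have e01 : E 2 0 1 = 0 := by simpa [e00] using e2 0
  have e10 : E 2 1 0 = 0 := by
    rw [← (hE 2).isHermitian.apply, e01, star_zero]
  have e11 : E 2 1 1 = 0 := by simpa [e10] using e2 1
  have hE2 : E 2 = 0 := by
    ext a b
    fin_cases a <;> fin_cases b
    exacts [e00, e01, e10, e11]
  have := hpos 2
  simp [hE2, prob_zero] at this

theorem not_antidistinguishable_duanB : ¬ Antidistinguishable fun i => pureState (duanB i) := by
  intro h
  have h' := h.transpose
  simp only [← pureState_star, ← star_duanA, star_star] at h'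
  exact not_antidistinguishable_duanA h'

end Antidistinguishability

/-! ### Conclusive marking: global yes, LOCC no -/

section Marking

/-- The functionals biorthogonal to the Duan states. -/
noncomputable def duanDual : Fin 4 → Fin 2 × Fin 2 → ℂ := fun i p =>
  ![!![1, -(1 + Complex.I) / 2; -(1 - Complex.I) / 2, 0],
    !![0, -(1 + Complex.I) / 2; -(1 - Complex.I) / 2, 1],
    !![0, 1; 1, 0],
    !![0, Complex.I; -Complex.I, 0]] i p.1 p.2

lemma duanDual_dotProduct (i j : Fin 4) : duanDual i ⬝ᵥ duan j = if j = i then 1 else 0 := by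
  have h := inv_sqrt_two_mul_self
  have h2 := Complex.I_sq
  fin_cases i <;> fin_cases j <;>
    simp [dotProduct, Fintype.sum_prod_type, duanDual, duan, duanA, duanB, ketZero, ketOne,
      ketPlus, ketIPlus, ketIMinus] <;> grind

/-- The values of a functional on the two-copy states of a party, up to normalization. -/
lemma functional_duanA_eq_zero_iff (f : (Fin 2 → Fin 2) → ℂ) (hf : f ![0, 1] ≠ 0) :
    ∃ a b c : ℂ,
      (f ⬝ᵥ seqVec duanA (pair 0 2 (by decide)) = 0 ↔ a = -1) ∧
      (f ⬝ᵥ seqVec duanA (pair 0 3 (by decide)) = 0 ↔ a = -Complex.I) ∧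
      (f ⬝ᵥ seqVec duanA (pair 2 1 (by decide)) = 0 ↔ c = -1) ∧
      (f ⬝ᵥ seqVec duanA (pair 3 1 (by decide)) = 0 ↔ c = Complex.I) ∧
      (f ⬝ᵥ seqVec duanA (pair 1 0 (by decide)) = 0 ↔ b = 0) ∧
      (f ⬝ᵥ seqVec duanA (pair 1 2 (by decide)) = 0 ↔ b = -c) ∧
      (f ⬝ᵥ seqVec duanA (pair 2 0 (by decide)) = 0 ↔ b = -a) ∧
      (f ⬝ᵥ seqVec duanA (pair 1 3 (by decide)) = 0 ↔ b = -(Complex.I * c)) ∧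
      (f ⬝ᵥ seqVec duanA (pair 3 0 (by decide)) = 0 ↔ b = Complex.I * a) := by
  have hr := inv_sqrt_two_ne_zero
  have hI := Complex.I_sq
  generalize hd : f ![0, 1] = d at hf
  -- Scaling the coefficient at 01 to 1 leaves those at 00, 10, 11 as `a`, `b`, `c`.
  refine ⟨f ![0, 0] / d, f ![1, 0] / d, f ![1, 1] / d, ?_⟩
  have ha : f ![0, 0] = d * (f ![0, 0] / d) := by field_simp
  have hb : f ![1, 0] = d * (f ![1, 0] / d) := by field_simp
  have hc : f ![1, 1] = d * (f ![1, 1] / d) := by field_simp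
  generalize f ![0, 0] / d = a at *
  generalize f ![1, 0] / d = b at *
  generalize f ![1, 1] / d = c at *
  simp only [dotProduct_seqVec_two, Fin.sum_univ_two, pair_apply_zero, pair_apply_one, duanA,
    ketZero, ketOne, ketPlus, ketIPlus, cons_val, Pi.smul_apply, Pi.add_apply, smul_eq_mul,
    ha, hb, hc, hd]
  generalize ((Real.sqrt 2 : ℝ) : ℂ)⁻¹ = r at *
  refine ⟨?_, ?_, ?_, ?_, ?_, ?_, ?_, ?_, ?_⟩ <;> grind

/-- Two functionals on `ℂ² ⊗ ℂ²` that do not vanish on `|0⟩|1⟩` cannot share out among them the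
other two-copy states of a party. -/
lemma not_exists_functionals_duanA (f g : (Fin 2 → Fin 2) → ℂ)
    (hf : f ⬝ᵥ seqVec duanA (pair 0 1 (by decide)) ≠ 0)
    (hg : g ⬝ᵥ seqVec duanA (pair 0 1 (by decide)) ≠ 0)
    (h : ∀ t, t ≠ pair 0 1 (by decide) → f ⬝ᵥ seqVec duanA t = 0 ∨ g ⬝ᵥ seqVec duanA t = 0) :
    False := by
  have key : ∀ a b c a' b' c' : ℂ, a = -1 → (a = -Complex.I ∨ a' = -Complex.I) →
      (c = -1 ∨ c' = -1) → (c = Complex.I ∨ c' = Complex.I) → (b = 0 ∨ b' = 0) →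
      (b = -c ∨ b' = -c') → (b = -a ∨ b' = -a') →
      (b = -(Complex.I * c) ∨ b' = -(Complex.I * c')) →
      (b = Complex.I * a ∨ b' = Complex.I * a') → False := by
    have hI := Complex.I_sq
    generalize Complex.I = i at *
    intro a b c a' b' c' ha h1 h2 h3 h4 h5 h6 h7 h8
    subst ha
    have ha' : a' = -i := by grind
    subst ha'
    -- With a = -1 and a' = -i, sequences 20 and 30 demand (b = 1 or b' = i) and (b = -i or b' = 1).
    -- But 10 makes `b` or `b'` zero, and then the other would need two values.
    have hc : (c = -1 ∧ c' = i) ∨ (c = i ∧ c' = -1) := by grind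
    rcases hc with ⟨rfl, rfl⟩ | ⟨rfl, rfl⟩ <;> grind
  have h01 : ∀ f : (Fin 2 → Fin 2) → ℂ,
      f ⬝ᵥ seqVec duanA (pair 0 1 (by decide)) = f ![0, 1] := fun f => by
    simp [dotProduct_seqVec_two, pair_apply_zero, pair_apply_one, duanA, ketZero, ketOne]
  rw [h01] at hf hg
  obtain ⟨a, b, c, f1, f2, f3, f4, f5, f6, f7, f8, f9⟩ := functional_duanA_eq_zero_iff f hf
  obtain ⟨a', b', c', g1, g2, g3, g4, g5, g6, g7, g8, g9⟩ := functional_duanA_eq_zero_iff g hg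
  have k1 := h (pair 0 2 (by decide)) (by decide)
  have k2 := h (pair 0 3 (by decide)) (by decide)
  have k3 := h (pair 2 1 (by decide)) (by decide)
  have k4 := h (pair 3 1 (by decide)) (by decide)
  have k5 := h (pair 1 0 (by decide)) (by decide)
  have k6 := h (pair 1 2 (by decide)) (by decide)
  have k7 := h (pair 2 0 (by decide)) (by decide)
  have k8 := h (pair 1 3 (by decide)) (by decide)
  have k9 := h (pair 3 0 (by decide)) (by decide)
  rw [f1, g1] at k1
  rw [f2, g2] at k2
  rw [f3, g3] at k3
  rw [f4, g4] at k4
  rw [f5, g5] at k5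
  rw [f6, g6] at k6
  rw [f7, g7] at k7
  rw [f8, g8] at k8
  rw [f9, g9] at k9
  -- The alternatives are symmetric in the two functionals, so either may be the one vanishing on
  -- 02.
  rcases k1 with k1 | k1
  · exact key a b c a' b' c' k1 k2 k3 k4 k5 k6 k7 k8 k9
  · exact key a' b' c' a b c k1 k2.symm k3.symm k4.symm k5.symm k6.symm k7.symm k8.symm k9.symm

theorem not_admitsCLSM_duan : ¬ AdmitsCLSM duan 2 := by
  rintro ⟨P, h0, hpos⟩
  have hseq : ∀ s : Fin 2 ↪ Fin 4,
      seqState duan s = pureState (prodVec (seqVec duanA s) (seqVec duanB s)) :=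
    seqState_eq duanA duanB
  simp only [hseq] at h0 hpos
  obtain ⟨f, g, hf, hg, hfg⟩ := P.exists_product_functional _ (seqVec duanA) (seqVec duanB)
    (pair 0 1 (by decide)) (h0 _) (hpos _)
  -- Conjugation turns Bob's functional into one on Alice's states with the same zeros.
  have hstar : ∀ t, g ⬝ᵥ seqVec duanB t = star (star g ⬝ᵥ seqVec duanA t) := fun t => by
    rw [seqVec_duanB, star_dotProduct, star_star, dotProduct_comm, star_dotProduct]
  simp only [hstar, star_eq_zero, ne_eq] at hg hfg
  exact not_exists_functionals_duanA f (star g) hf hg hfg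

theorem admitsGlobalCSM_duan : AdmitsGlobalCSM duan 2 :=
  admitsGlobalCSM_of_dual duan duanDual (fun i j hij => by rw [duanDual_dotProduct, if_neg hij])
    fun i => by rw [duanDual_dotProduct, if_pos rfl]; exact one_ne_zero

theorem admitsStrongLSAM_duan : AdmitsStrongLSAM duan 2 1 :=
  admitsStrongLSAM_of_antidistinguishable duanA duanB star_duanB_dotProduct_self
    antidistinguishable_localSeqState_duanA

end Marking

end Antimarking

theorem mainTheorem8 :
    -- the Duan states admit (2,1)-LSAM, also in the strong sense
    Antimarking.AdmitsLSAM Antimarking.duan 2 1 ∧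
    Antimarking.AdmitsStrongLSAM Antimarking.duan 2 1 ∧
    -- the four triples cover all sequences of two distinct indices
    (∀ k, Function.Injective (Antimarking.duanTriple k)) ∧
    (∀ s : Fin 2 ↪ Fin 4, ∃ k l, Antimarking.duanTriple k l = s) ∧
    -- each triple of local two-copy states is antidistinguishable, for Alice and for Bob
    (∀ k, Antimarking.Antidistinguishable
      (fun l => Antimarking.localSeqState Antimarking.duanA (Antimarking.duanTriple k l))) ∧
    (∀ k, Antimarking.Antidistinguishable
      (fun l => Antimarking.localSeqState Antimarking.duanB (Antimarking.duanTriple k l))) ∧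
    -- and so is each party's whole two-copy local set
    Antimarking.Antidistinguishable
      (fun s : Fin 2 ↪ Fin 4 => Antimarking.localSeqState Antimarking.duanA s) ∧
    Antimarking.Antidistinguishable
      (fun s : Fin 2 ↪ Fin 4 => Antimarking.localSeqState Antimarking.duanB s) ∧
    -- whereas neither party's one-copy local set is antidistinguishable
    ¬ Antimarking.Antidistinguishable
      (fun i => Antimarking.pureState (Antimarking.duanA i)) ∧
    ¬ Antimarking.Antidistinguishable
      (fun i => Antimarking.pureState (Antimarking.duanB i)) ∧
    -- nonlocality for 2-CLSM: conclusive marking is possible globally but not by LOCC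
    Antimarking.AdmitsGlobalCSM Antimarking.duan 2 ∧
    ¬ Antimarking.AdmitsCLSM Antimarking.duan 2 := by
  refine ⟨Antimarking.admitsStrongLSAM_duan.admitsLSAM, Antimarking.admitsStrongLSAM_duan,
    Antimarking.duanTriple_injective, Antimarking.exists_duanTriple_eq,
    Antimarking.antidistinguishable_duanTriple, fun k => ?_,
    Antimarking.antidistinguishable_localSeqState_duanA, ?_,
    Antimarking.not_antidistinguishable_duanA, Antimarking.not_antidistinguishable_duanB,
    Antimarking.admitsGlobalCSM_duan, Antimarking.not_admitsCLSM_duan⟩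
  · simp only [Antimarking.localSeqState_duanB]
    exact (Antimarking.antidistinguishable_duanTriple k).transpose
  · simp only [Antimarking.localSeqState_duanB]
    exact Antimarking.antidistinguishable_localSeqState_duanA.transpose
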